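/- Let $n\ge 1$ and $r\ge 0$ be integers. Let $\mathbf X_1,\dots,\mathbf X_r$ be the generic $n\times n$ matrices, whose entries are the $rn^2$ coordinate functions on $\mathfrak{gl}(n,\mathbb C)^{\times r}$. Let $\mathbb C[\mathfrak Y_r]=\mathbb C[\mathfrak{gl}(n,\mathbb C)^{\times r}]^{\mathrm{GL}(n,\mathbb C)}$ be the algebra of polynomials on $\mathfrak{gl}(n,\mathbb C)^{\times r}$ invariant under simultaneous conjugation by $\mathrm{GL}(n,\mathbb C)$, let $\mathbb C[\mathfrak X_r]=\mathbb C[\mathrm{SL}(n,\mathbb C)^{\times r}]^{\mathrm{SL}(n,\mathbb C)}$ be the algebra of regular functions on $\mathrm{SL}(n,\mathbb C)^{\times r}$ invariant under simultaneous conjugation by $\mathrm{SL}(n,\mathbb C)$, and let $\Pi:\mathbb C[\mathfrak Y_r]\to\mathbb C[\mathfrak X_r]$ be the restriction of functions. A generating set of the $\mathbb C$-algebra $\mathbb C[\mathfrak Y_r]$ is called a set of Procesi generators if each of its elements is the trace $\mathrm{tr}(\mathbf W)$ of a word $\mathbf W$ in $\mathbf X_1,\dots,\mathbf X_r$, and none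 of its elements has the form $\mathrm{tr}(\mathbf W_1\mathbf X_k^n\mathbf W_2)$ with $1\le k\le r$ and words $\mathbf W_1,\mathbf W_2$ that are not both empty. A generating set is minimal if no proper subset of it generates. Let $\mathcal G$ be a minimal set of Procesi generators of $\mathbb C[\mathfrak Y_r]$. Then $\Pi\left(\mathcal G\setminus\{\mathrm{tr}(\mathbf X_1^n),\dots,\mathrm{tr}(\mathbf X_r^n)\}\right)$ is a minimal generating set of the $\mathbb C$-algebra $\mathbb C[\mathfrak X_r]$, and it has exactly $r$ elements fewer than $\mathcal G$. Moreover, both sets have the least possible cardinality among generating sets of $\mathbb C[\mathfrak X_r]$ and $\mathbb C[\mathfrak Y_r]$, respectively. In particular, if $N(R)$ denotes the least number of generators of a $\mathbb C$-algebra $R$, then $N(\mathbb C[\mathfrak X_r])+r=N(\mathbb C[\mathfrak Y_r])$. -/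

import Mathlib

open scoped MatrixGroups

namespace TraceInv

/-- `ℂ[gl(n)^r]`: the polynomial ring in the entries `x^k_{ij}`, indexed by `(k, i, j)`. -/
abbrev PolyRing (n r : ℕ) : Type := MvPolynomial (Fin r × Fin n × Fin n) ℂ

/-- Evaluation of a polynomial at an `r`-tuple of complex `n × n` matrices. -/
noncomputable def evalAt {n r : ℕ} (A : Fin r → Matrix (Fin n) (Fin n) ℂ) :
    PolyRing n r →ₐ[ℂ] ℂ :=
  MvPolynomial.aeval fun x => A x.1 x.2.1 x.2.2

/-- The `k`-th generic matrix. -/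
noncomputable def genericMatrix (n r : ℕ) (k : Fin r) :
    Matrix (Fin n) (Fin n) (PolyRing n r) :=
  Matrix.of fun i j => MvPolynomial.X (k, i, j)

/-- The trace of a word in the generic matrices. -/
noncomputable def traceWord (n : ℕ) {r : ℕ} (w : List (Fin r)) : PolyRing n r :=
  (w.map (genericMatrix n r)).prod.trace

/-- `ℂ[gl(n)^r // GL(n)]`: the polynomials on `gl(n)^r` that are invariant under simultaneous
conjugation by `GL(n, ℂ)`. -/
noncomputable def invGL (n r : ℕ) : Subalgebra ℂ (PolyRing n r) where
  carrier := {p | ∀ (g : GL (Fin n) ℂ) (A : Fin r → Matrix (Fin n) (Fin n) ℂ),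
    evalAt (fun k => (g : Matrix (Fin n) (Fin n) ℂ) * A k *
      ((g⁻¹ : GL (Fin n) ℂ) : Matrix (Fin n) (Fin n) ℂ)) p = evalAt A p}
  mul_mem' hp hq g A := by rw [map_mul, map_mul, hp g A, hq g A]
  add_mem' hp hq g A := by rw [map_add, map_add, hp g A, hq g A]
  algebraMap_mem' c g A := by rw [AlgHom.commutes, AlgHom.commutes]

/-- Restriction of a polynomial on `gl(n)^r` to a function on `SL(n)^r`. -/
noncomputable def restrictSL (n r : ℕ) :
    PolyRing n r →ₐ[ℂ] ((Fin r → SL(n, ℂ)) → ℂ) :=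
  AlgHom.pi fun A => evalAt fun k => (A k : Matrix (Fin n) (Fin n) ℂ)

/-- `ℂ[SL(n)^r // SL(n)]`: the regular functions on the affine variety `SL(n)^r` (restrictions of
polynomials in the matrix entries) that are invariant under simultaneous conjugation by
`SL(n, ℂ)`. -/
noncomputable def invSL (n r : ℕ) : Subalgebra ℂ ((Fin r → SL(n, ℂ)) → ℂ) where
  carrier := {f | f ∈ (restrictSL n r).range ∧
    ∀ (g : SL(n, ℂ)) (A : Fin r → SL(n, ℂ)), f (fun k => g * A k * g⁻¹) = f A}
  mul_mem' hp hq := ⟨mul_mem hp.1 hq.1, fun g A => by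
    rw [Pi.mul_apply, Pi.mul_apply, hp.2 g A, hq.2 g A]⟩
  add_mem' hp hq := ⟨add_mem hp.1 hq.1, fun g A => by
    rw [Pi.add_apply, Pi.add_apply, hp.2 g A, hq.2 g A]⟩
  algebraMap_mem' c := ⟨Subalgebra.algebraMap_mem _ c, fun _ _ => rfl⟩

theorem restrictSL_mem {n r : ℕ} (p : invGL n r) :
    restrictSL n r (p : PolyRing n r) ∈ invSL n r := by
  refine ⟨⟨_, rfl⟩, fun g A => ?_⟩
  have h := p.2 (g : GL (Fin n) ℂ) (fun k => (A k : Matrix (Fin n) (Fin n) ℂ))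
  rw [← map_inv] at h
  change evalAt (fun k => ((g * A k * g⁻¹ : SL(n, ℂ)) : Matrix (Fin n) (Fin n) ℂ)) p.1 =
    evalAt (fun k => (A k : Matrix (Fin n) (Fin n) ℂ)) p.1
  rw [← h]
  congr 2

/-- The projection `ℂ[gl(n)^r // GL(n)] → ℂ[SL(n)^r // SL(n)]`, restriction of functions. -/
noncomputable def proj (n r : ℕ) : invGL n r →ₐ[ℂ] invSL n r :=
  ((restrictSL n r).comp (invGL n r).val).codRestrict (invSL n r) restrictSL_mem

theorem evalAt_traceWord {n r : ℕ} (A : Fin r → Matrix (Fin n) (Fin n) ℂ) (w : List (Fin r)) :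
    evalAt A (traceWord n w) = (w.map A).prod.trace := by
  have h : ∀ k, (evalAt A).mapMatrix (genericMatrix n r k) = A k := fun k => by
    ext i j; simp [genericMatrix, evalAt]
  have h2 : (evalAt A).mapMatrix (w.map (genericMatrix n r)).prod = (w.map A).prod := by
    rw [map_list_prod, List.map_map]
    congr 1
    exact List.map_congr_left fun k _ => h k
  rw [← h2, traceWord, Matrix.trace, Matrix.trace, map_sum]
  rfl

theorem traceWord_mem (n : ℕ) {r : ℕ} (w : List (Fin r)) : traceWord n w ∈ invGL n r := by
  intro g A
  rw [evalAt_traceWord, evalAt_traceWord]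
  have h : (w.map fun k => (g : Matrix (Fin n) (Fin n) ℂ) * A k *
      ((g⁻¹ : GL (Fin n) ℂ) : Matrix (Fin n) (Fin n) ℂ)).prod =
      (g : Matrix (Fin n) (Fin n) ℂ) * (w.map A).prod *
      ((g⁻¹ : GL (Fin n) ℂ) : Matrix (Fin n) (Fin n) ℂ) := by
    induction w with
    | nil => simp
    | cons k w ih =>
      rw [List.map_cons, List.prod_cons, ih, List.map_cons, List.prod_cons]
      simp only [mul_assoc]
      rw [Units.inv_mul_cancel_left]
  rw [h, Matrix.trace_mul_cycle, Units.inv_mul, one_mul]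

/-- The trace of a word as an element of `ℂ[gl(n)^r // GL(n)]`. -/
noncomputable def traceInv (n : ℕ) {r : ℕ} (w : List (Fin r)) : invGL n r :=
  ⟨traceWord n w, traceWord_mem n w⟩

/-- The set `{tr(X_1^n), …, tr(X_r^n)}`. -/
def powerTraces (n r : ℕ) : Set (invGL n r) :=
  Set.range fun k : Fin r => traceInv n (List.replicate n k)

/-- `S` generates the `ℂ`-algebra `R`, and no proper subset of `S` does. -/
def IsMinimalGenerating {R : Type*} [CommRing R] [Algebra ℂ R] (S : Set R) : Prop :=
  Minimal (fun T : Set R => Algebra.adjoin ℂ T = ⊤) S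

/-- The least cardinality of a generating set of the `ℂ`-algebra `R` (`⊤` if `R` is not finitely
generated). -/
noncomputable def minNumGenerators (R : Type*) [CommRing R] [Algebra ℂ R] : ℕ∞ :=
  ⨅ T ∈ {T : Set R | Algebra.adjoin ℂ T = ⊤}, T.encard

/-- Procesi generators: a generating set consisting of traces of words in the generic matrices,
none of which has the form `tr(W₁ X_k^n W₂)` with `W₁` or `W₂` a nonempty word. -/
structure IsProcesiGenerators {n r : ℕ} (S : Set (invGL n r)) : Prop where
  adjoin_eq_top : Algebra.adjoin ℂ S = ⊤
  isTrace : ∀ s ∈ S, ∃ w : List (Fin r), s = traceInv n w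
  no_power : ∀ s ∈ S, ∀ (k : Fin r) (w₁ w₂ : List (Fin r)), (w₁ ≠ [] ∨ w₂ ≠ []) →
    s ≠ traceInv n (w₁ ++ List.replicate n k ++ w₂)

end TraceInv

/-! For an algebra with a character ε and I = ker ε, the differentials of any generating set span
I/I². Hence a generating set with linearly independent differentials is minimal and of least
cardinality. For the graded algebra of invariants on gl(n)^r, with ε evaluation at 0, a graded
Nakayama argument gives a converse: the differentials of a minimal homogeneous generating set form a
basis of I/I².

The relation det = 1 is not homogeneous, so on SL(n)^r the base point is the identity tuple. Two
facts link it to 0. The substitution X_k ↦ X_k + 1 preserves top-degree parts, so homogeneous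
elements independent at 0 stay independent at 1. Restriction to SL(n)^r is surjective on invariants,
and modulo decomposables at 1 its kernel is spanned by the determinants: multiplying multidegree
components by powers of det X_k moves them into a cube of side n, where a polynomial vanishing on
SL(n)^r is zero. So if H is a homogeneous basis at 0 containing the determinants, H without them
restricts to a generating set with independent differentials.

Finally, tr(X_k^n) is exchanged for det X_k. Cayley–Hamilton makes tr(X_k^n) a multiple of det X_k
modulo decomposables, and evaluation at a cyclic permutation matrix shows that the determinants are
independent of all other traces of words. -/

namespace TraceInv

/-! ### Cotangent spaces and numbers of generators -/

section Cotangent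

variable {R : Type*} [CommRing R] [Algebra ℂ R] (ε : R →ₐ[ℂ] ℂ)

/-- `ℂ·1 + I²` for the augmentation ideal `I = ker ε`. -/
def decomposables : Submodule ℂ R :=
  Submodule.span ℂ ({1} ∪ {x | ∃ a b, ε a = 0 ∧ ε b = 0 ∧ x = a * b})

/-- The universal `ε`-derivation `R → I / I² = R / (ℂ·1 + I²)`. -/
noncomputable def cot : R →ₗ[ℂ] R ⧸ decomposables ε := (decomposables ε).mkQ

theorem cot_eq_zero {x : R} : cot ε x = 0 ↔ x ∈ decomposables ε :=
  Submodule.Quotient.mk_eq_zero _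

theorem one_mem_decomposables : (1 : R) ∈ decomposables ε :=
  Submodule.subset_span (Or.inl rfl)

theorem algebraMap_mem_decomposables (c : ℂ) : algebraMap ℂ R c ∈ decomposables ε := by
  rw [Algebra.algebraMap_eq_smul_one]
  exact Submodule.smul_mem _ _ (one_mem_decomposables ε)

theorem mul_mem_decomposables {a b : R} (ha : ε a = 0) (hb : ε b = 0) :
    a * b ∈ decomposables ε :=
  Submodule.subset_span (Or.inr ⟨a, b, ha, hb, rfl⟩)

theorem cot_algebraMap (c : ℂ) : cot ε (algebraMap ℂ R c) = 0 :=
  (cot_eq_zero ε).2 (algebraMap_mem_decomposables ε c)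

/-- Leibniz rule: expand (a - ε a)(b - ε b), which lies in I². -/
theorem cot_mul (a b : R) : cot ε (a * b) = ε a • cot ε b + ε b • cot ε a := by
  rw [← sub_eq_zero, ← map_smul, ← map_smul, ← map_add, ← map_sub, cot_eq_zero]
  have h : a * b - (ε a • b + ε b • a) =
      (a - algebraMap ℂ R (ε a)) * (b - algebraMap ℂ R (ε b)) - algebraMap ℂ R (ε a * ε b) := by
    rw [Algebra.smul_def, Algebra.smul_def, map_mul]
    ring
  rw [h]
  refine sub_mem (mul_mem_decomposables ε ?_ ?_) (algebraMap_mem_decomposables ε _) <;> simp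

/-- The elements whose differential lies in a given subspace form a subalgebra. -/
def cotComap (W : Submodule ℂ (R ⧸ decomposables ε)) : Subalgebra ℂ R where
  carrier := {x | cot ε x ∈ W}
  mul_mem' {a b} ha hb := by
    change cot ε (a * b) ∈ W
    rw [cot_mul]
    exact add_mem (W.smul_mem _ hb) (W.smul_mem _ ha)
  add_mem' {a b} ha hb := by
    change cot ε (a + b) ∈ W
    rw [map_add]
    exact add_mem ha hb
  algebraMap_mem' c := by
    change cot ε _ ∈ W
    rw [cot_algebraMap]
    exact zero_mem _

theorem mem_cotComap {W : Submodule ℂ (R ⧸ decomposables ε)} {x : R} :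
    x ∈ cotComap ε W ↔ cot ε x ∈ W := Iff.rfl

theorem span_cot_eq_top {T : Set R} (hT : Algebra.adjoin ℂ T = ⊤) :
    Submodule.span ℂ (cot ε '' T) = ⊤ := by
  have h : Algebra.adjoin ℂ T ≤ cotComap ε (Submodule.span ℂ (cot ε '' T)) :=
    Algebra.adjoin_le fun t ht => Submodule.subset_span ⟨t, ht, rfl⟩
  rw [hT] at h
  refine eq_top_iff.2 fun v _ => ?_
  obtain ⟨x, rfl⟩ := (decomposables ε).mkQ_surjective v
  exact h (Algebra.mem_top (x := x))

/-- Both cardinalities are compared with dim I/I². Working in `ℕ∞` avoids any appeal to finite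
generation. -/
theorem encard_le_of_linearIndepOn_cot {S T : Set R} (hS : LinearIndepOn ℂ (cot ε) S)
    (hT : Algebra.adjoin ℂ T = ⊤) : S.encard ≤ T.encard := by
  have h1 := hS.encard_le_toENat_rank
  have h2 := rank_span_le (R := ℂ) (cot ε '' T)
  rw [span_cot_eq_top ε hT, rank_top] at h2
  refine h1.trans ((OrderHomClass.mono Cardinal.toENat h2).trans ?_)
  exact Set.encard_image_le _ _

theorem encard_eq_minNumGenerators {S : Set R} (hS : LinearIndepOn ℂ (cot ε) S)
    (hS' : Algebra.adjoin ℂ S = ⊤) : S.encard = minNumGenerators R :=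
  le_antisymm (le_iInf₂ fun _ hT => encard_le_of_linearIndepOn_cot ε hS hT) (iInf₂_le S hS')

theorem isMinimalGenerating_of_linearIndepOn_cot {S : Set R} (hS : LinearIndepOn ℂ (cot ε) S)
    (hS' : Algebra.adjoin ℂ S = ⊤) : IsMinimalGenerating S := by
  refine ⟨hS', fun T hT hTS s hs => ?_⟩
  have h : cot ε s ∈ Submodule.span ℂ (cot ε '' T) := by
    rw [span_cot_eq_top ε hT]
    trivial
  by_contra hsT
  refine hS.notMem_span hs (Submodule.span_mono (Set.image_mono ?_) h)
  exact fun t ht => ⟨hTS ht, fun h => hsT (h ▸ ht)⟩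

theorem map_mem_decomposables {R' : Type*} [CommRing R'] [Algebra ℂ R'] (ε' : R' →ₐ[ℂ] ℂ)
    (f : R →ₐ[ℂ] R') (hf : ∀ x, ε' (f x) = ε x) {x : R} (hx : x ∈ decomposables ε) :
    f x ∈ decomposables ε' := by
  refine Submodule.span_induction (p := fun x _ => f x ∈ decomposables ε') ?_ ?_ ?_ ?_ hx
  · rintro x (rfl | ⟨a, b, ha, hb, rfl⟩)
    · rw [map_one]
      exact one_mem_decomposables ε'
    · rw [map_mul]
      exact mul_mem_decomposables ε' ((hf a).trans ha) ((hf b).trans hb)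
  · rw [map_zero]
    exact zero_mem _
  · intro x y _ _ hx hy
    rw [map_add]
    exact add_mem hx hy
  · intro c x _ hx
    rw [map_smul]
    exact Submodule.smul_mem _ c hx

/-- A surjection compatible with the characters maps I onto I', hence I² onto I'². -/
theorem exists_decomposables_preimage {R' : Type*} [CommRing R'] [Algebra ℂ R']
    (ε' : R' →ₐ[ℂ] ℂ) (f : R →ₐ[ℂ] R') (hf : ∀ x, ε' (f x) = ε x)
    (hsurj : Function.Surjective f) {y : R'} (hy : y ∈ decomposables ε') :
    ∃ x ∈ decomposables ε, f x = y := by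
  suffices h : decomposables ε' ≤ (decomposables ε).map f.toLinearMap from h hy
  refine Submodule.span_le.2 ?_
  rintro x (rfl | ⟨a, b, ha, hb, rfl⟩)
  · exact ⟨1, one_mem_decomposables ε, map_one f⟩
  · obtain ⟨a, rfl⟩ := hsurj a
    obtain ⟨b, rfl⟩ := hsurj b
    exact ⟨a * b, mul_mem_decomposables ε ((hf a).symm.trans ha) ((hf b).symm.trans hb),
      map_mul f a b⟩

end Cotangent

theorem linearIndepOn_of_ker_le {K M V W : Type*} [Field K] [AddCommGroup M] [Module K M]
    [AddCommGroup V] [Module K V] [AddCommGroup W] [Module K W] (f : M →ₗ[K] V) (g : M →ₗ[K] W)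
    (h : LinearMap.ker g ≤ LinearMap.ker f) {s : Set M} (hs : LinearIndepOn K f s) :
    LinearIndepOn K g s := by
  rw [linearIndepOn_iff'] at hs ⊢
  intro t c hts hc
  refine hs t c hts ?_
  have : ∑ i ∈ t, c i • i ∈ LinearMap.ker g := by simpa using hc
  simpa using h this

end TraceInv
-- Gradings on the invariants and graded Nakayama
namespace TraceInv

open MvPolynomial

section Weighted

variable {σ τ M R : Type*} [AddCommMonoid M] [CommSemiring R]

theorem IsWeightedHomogeneous.aeval' {w : σ → M} {w' : τ → M} {f : σ → MvPolynomial τ R}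
    (hf : ∀ i, IsWeightedHomogeneous w' (f i) (w i)) {p : MvPolynomial σ R} {m : M}
    (hp : IsWeightedHomogeneous w p m) : IsWeightedHomogeneous w' (aeval f p) m := by
  rw [aeval_def, eval₂_eq]
  refine IsWeightedHomogeneous.sum _ _ _ fun s hs => ?_
  refine IsWeightedHomogeneous.C_mul ?_ _
  rw [← hp (mem_support_iff.1 hs), Finsupp.weight_apply]
  exact IsWeightedHomogeneous.prod _ _ _ fun i _ => (hf i).pow _

theorem aeval_weightedHomogeneousComponent {w : σ → M} {w' : τ → M} {f : σ → MvPolynomial τ R}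
    (hf : ∀ i, IsWeightedHomogeneous w' (f i) (w i)) (p : MvPolynomial σ R) (m : M) :
    aeval f (weightedHomogeneousComponent w m p) =
      weightedHomogeneousComponent w' m (aeval f p) := by
  classical
  induction p using MvPolynomial.induction_on' with
  | monomial s c =>
    have h := isWeightedHomogeneous_monomial w s c rfl
    have h' := IsWeightedHomogeneous.aeval' hf h
    by_cases hm : m = Finsupp.weight w s
    · subst hm
      rw [h.weightedHomogeneousComponent_same, h'.weightedHomogeneousComponent_same]
    · rw [h.weightedHomogeneousComponent_ne m hm, h'.weightedHomogeneousComponent_ne m hm, map_zero]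
  | add p q hp hq => rw [map_add, map_add, hp, hq, map_add, map_add]

theorem homogeneousComponent_mul (m : ℕ) (a b : MvPolynomial σ R) :
    homogeneousComponent m (a * b) =
      ∑ i ∈ Finset.range (a.totalDegree + 1), ∑ j ∈ Finset.range (b.totalDegree + 1),
        if i + j = m then homogeneousComponent i a * homogeneousComponent j b else 0 := by
  conv_lhs => rw [← sum_homogeneousComponent a, ← sum_homogeneousComponent b]
  rw [Finset.sum_mul_sum, map_sum]
  refine Finset.sum_congr rfl fun i _ => ?_
  rw [map_sum]
  refine Finset.sum_congr rfl fun j _ => ?_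
  rw [homogeneousComponent_of_mem (((homogeneousComponent_isHomogeneous i a).mul
    (homogeneousComponent_isHomogeneous j b)))]
  simp only [eq_comm]

end Weighted

variable {n r : ℕ}

theorem evalAt_eq_eval (A : Fin r → Matrix (Fin n) (Fin n) ℂ) (p : PolyRing n r) :
    evalAt A p = eval (fun x => A x.1 x.2.1 x.2.2) p :=
  DFunLike.congr_fun (coe_aeval_eq_eval fun x : Fin r × Fin n × Fin n => A x.1 x.2.1 x.2.2) p

theorem ext_evalAt {p q : PolyRing n r} (h : ∀ A, evalAt A p = evalAt A q) : p = q := by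
  refine MvPolynomial.funext fun x => ?_
  have := h fun k => Matrix.of fun i j => x (k, i, j)
  rwa [evalAt_eq_eval, evalAt_eq_eval] at this

/-- Substitution of `g X_k g⁻¹` for `X_k`. -/
noncomputable def conjHom (g : GL (Fin n) ℂ) : PolyRing n r →ₐ[ℂ] PolyRing n r :=
  aeval fun x => ∑ l, (∑ j, C ((g : Matrix (Fin n) (Fin n) ℂ) x.2.1 j) * X (x.1, j, l)) *
    C (((g⁻¹ : GL (Fin n) ℂ) : Matrix (Fin n) (Fin n) ℂ) l x.2.2)

theorem evalAt_conjHom (g : GL (Fin n) ℂ) (A : Fin r → Matrix (Fin n) (Fin n) ℂ)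
    (p : PolyRing n r) : evalAt A (conjHom g p) =
      evalAt (fun k => (g : Matrix (Fin n) (Fin n) ℂ) * A k *
      ((g⁻¹ : GL (Fin n) ℂ) : Matrix (Fin n) (Fin n) ℂ)) p := by
  have : (evalAt A).comp (conjHom g) = evalAt (fun k => (g : Matrix (Fin n) (Fin n) ℂ) * A k *
      ((g⁻¹ : GL (Fin n) ℂ) : Matrix (Fin n) (Fin n) ℂ)) := by
    ext ⟨k, i, j⟩
    simp [conjHom, evalAt, Matrix.mul_apply]
  exact DFunLike.congr_fun this p

theorem mem_invGL_iff {p : PolyRing n r} : p ∈ invGL n r ↔ ∀ g, conjHom g p = p := by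
  refine ⟨fun h g => ext_evalAt fun A => ?_, fun h g A => ?_⟩
  · rw [evalAt_conjHom, h g A]
  · rw [← evalAt_conjHom, h g]

/-- Conjugation sends each entry of X_k to a linear combination of entries of the same X_k, so it
respects every weight depending on k alone. This covers both total degree and multidegree. -/
theorem weightedHomogeneousComponent_conjHom {M : Type*} [AddCommMonoid M] (ω : Fin r → M) (m : M)
    (g : GL (Fin n) ℂ) (p : PolyRing n r) :
    conjHom g (weightedHomogeneousComponent (fun x => ω x.1) m p) =
      weightedHomogeneousComponent (fun x => ω x.1) m (conjHom g p) := by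
  refine aeval_weightedHomogeneousComponent (fun x => ?_) p m
  refine IsWeightedHomogeneous.sum _ _ _ fun l _ => ?_
  rw [mul_comm]
  refine IsWeightedHomogeneous.C_mul (IsWeightedHomogeneous.sum _ _ _ fun j _ => ?_) _
  exact (isWeightedHomogeneous_X ℂ (fun x : Fin r × Fin n × Fin n => ω x.1) (x.1, j, l)).C_mul _

theorem weightedHomogeneousComponent_mem_invGL {M : Type*} [AddCommMonoid M] (ω : Fin r → M) (m : M)
    {p : PolyRing n r} (hp : p ∈ invGL n r) :
    weightedHomogeneousComponent (fun x => ω x.1) m p ∈ invGL n r :=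
  mem_invGL_iff.2 fun g => by
    rw [weightedHomogeneousComponent_conjHom, mem_invGL_iff.1 hp g]

theorem homogeneousComponent_mem_invGL (m : ℕ) {p : PolyRing n r} (hp : p ∈ invGL n r) :
    homogeneousComponent m p ∈ invGL n r :=
  weightedHomogeneousComponent_mem_invGL (fun _ => 1) m hp

/-- The homogeneous components of an invariant. -/
noncomputable def invComponent (n r m : ℕ) : invGL n r →ₗ[ℂ] invGL n r :=
  ((homogeneousComponent m).comp (invGL n r).val.toLinearMap).codRestrict
    (Subalgebra.toSubmodule (invGL n r)) fun p => homogeneousComponent_mem_invGL m p.2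

theorem coe_invComponent (m : ℕ) (p : invGL n r) :
    (invComponent n r m p : PolyRing n r) = homogeneousComponent m (p : PolyRing n r) := rfl

theorem invComponent_isHomogeneous (m : ℕ) (p : invGL n r) :
    (invComponent n r m p : PolyRing n r).IsHomogeneous m :=
  homogeneousComponent_isHomogeneous m _

theorem invComponent_of_isHomogeneous {m j : ℕ} {p : invGL n r}
    (hp : (p : PolyRing n r).IsHomogeneous m) : invComponent n r j p = if j = m then p else 0 := by
  apply Subtype.ext
  rw [coe_invComponent, homogeneousComponent_of_mem hp]
  split_ifs <;> rfl

theorem sum_invComponent (p : invGL n r) :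
    ∑ i ∈ Finset.range ((p : PolyRing n r).totalDegree + 1), invComponent n r i p = p := by
  apply Subtype.ext
  rw [AddSubmonoidClass.coe_finsetSum]
  exact sum_homogeneousComponent _

theorem invComponent_mul (m : ℕ) (a b : invGL n r) :
    invComponent n r m (a * b) =
      ∑ i ∈ Finset.range ((a : PolyRing n r).totalDegree + 1),
        ∑ j ∈ Finset.range ((b : PolyRing n r).totalDegree + 1),
          if i + j = m then invComponent n r i a * invComponent n r j b else 0 := by
  apply Subtype.ext
  rw [coe_invComponent, MulMemClass.coe_mul, homogeneousComponent_mul,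
    AddSubmonoidClass.coe_finsetSum]
  refine Finset.sum_congr rfl fun i _ => ?_
  rw [AddSubmonoidClass.coe_finsetSum]
  refine Finset.sum_congr rfl fun j _ => ?_
  split_ifs <;> rfl

/-- Evaluation of invariants at a point of `gl(n)^r`. -/
noncomputable def invEval (A : Fin r → Matrix (Fin n) (Fin n) ℂ) : invGL n r →ₐ[ℂ] ℂ :=
  (evalAt A).comp (invGL n r).val

theorem invEval_apply (A : Fin r → Matrix (Fin n) (Fin n) ℂ) (p : invGL n r) :
    invEval A p = evalAt A (p : PolyRing n r) := rfl

theorem evalAt_zero (p : PolyRing n r) : evalAt 0 p = coeff 0 p := by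
  rw [evalAt_eq_eval]
  change eval (fun _ => 0) p = _
  rw [eval_zero', constantCoeff_eq]

theorem invComponent_zero (p : invGL n r) :
    invComponent n r 0 p = algebraMap ℂ _ (invEval 0 p) := by
  apply Subtype.ext
  rw [coe_invComponent, homogeneousComponent_zero, invEval_apply, evalAt_zero]
  rfl

/-- Every element of `S` is a homogeneous polynomial. -/
def IsHomogeneousSet (S : Set (invGL n r)) : Prop :=
  ∀ s ∈ S, ∃ m, (s : PolyRing n r).IsHomogeneous m

/-- In positive degree, decomposables are sums of products of elements of lower degree. -/
theorem invComponent_mem_of_decomposables {m : ℕ} (hm : m ≠ 0) {C : Subalgebra ℂ (invGL n r)}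
    (hC : ∀ j < m, ∀ p, invComponent n r j p ∈ C) {x : invGL n r}
    (hx : x ∈ decomposables (invEval (n := n) (r := r) 0)) : invComponent n r m x ∈ C := by
  suffices h : decomposables (invEval (n := n) (r := r) 0) ≤
      (Subalgebra.toSubmodule C).comap (invComponent n r m) from h hx
  refine Submodule.span_le.2 ?_
  rintro x (rfl | ⟨a, b, ha, hb, rfl⟩)
  · change invComponent n r m 1 ∈ C
    rw [invComponent_of_isHomogeneous (isHomogeneous_one _ _), if_neg hm]
    exact zero_mem _
  · change invComponent n r m (a * b) ∈ C
    rw [invComponent_mul]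
    refine sum_mem fun i _ => sum_mem fun j _ => ?_
    split_ifs with hij
    · rcases Nat.eq_zero_or_pos i with rfl | hi
      · rw [invComponent_zero, ha, map_zero, zero_mul]
        exact zero_mem _
      rcases Nat.eq_zero_or_pos j with rfl | hj
      · rw [invComponent_zero b, hb, map_zero, mul_zero]
        exact zero_mem _
      exact mul_mem (hC _ (by omega) _) (hC _ (by omega) _)
    · exact zero_mem _

/-- Graded Nakayama, by strong induction on degree: modulo the span of H an invariant is
decomposable, and the positive-degree components of a decomposable are built from invariants of
lower degree. -/
theorem adjoin_eq_top_of_span_cot {H : Set (invGL n r)} (hH : IsHomogeneousSet H)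
    (hspan : Submodule.span ℂ (cot (invEval (n := n) (r := r) 0) '' H) = ⊤) :
    Algebra.adjoin ℂ H = ⊤ := by
  have key : ∀ m, ∀ p, invComponent n r m p ∈ Algebra.adjoin ℂ H := by
    intro m
    induction m using Nat.strong_induction_on with
    | _ m ih =>
    intro p
    rcases eq_or_ne m 0 with rfl | hm
    · rw [invComponent_zero]
      exact Subalgebra.algebraMap_mem _ _
    have hp : cot (invEval (n := n) (r := r) 0) p ∈
        (Submodule.span ℂ H).map (cot (invEval (n := n) (r := r) 0)) := by
      rw [Submodule.map_span, hspan]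
      trivial
    obtain ⟨y, hy, hyp⟩ := hp
    have hx := invComponent_mem_of_decomposables hm ih
      ((cot_eq_zero _).1 (show cot _ (p - y) = 0 by rw [map_sub, hyp, sub_self]))
    have hy' : invComponent n r m y ∈ Algebra.adjoin ℂ H := by
      suffices h : Submodule.span ℂ H ≤
          (Subalgebra.toSubmodule (Algebra.adjoin ℂ H)).comap (invComponent n r m) from h hy
      refine Submodule.span_le.2 fun h hh => ?_
      obtain ⟨j, hj⟩ := hH h hh
      change invComponent n r m h ∈ Algebra.adjoin ℂ H
      rw [invComponent_of_isHomogeneous hj]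
      split_ifs
      · exact Algebra.subset_adjoin hh
      · exact zero_mem _
    rw [map_sub] at hx
    simpa using add_mem hx hy'
  refine eq_top_iff.2 fun p _ => ?_
  rw [← sum_invComponent p]
  exact sum_mem fun i _ => key i p

/-- A subset of G whose differentials form a basis already generates, so by minimality it is G. -/
theorem linearIndepOn_cot_of_isMinimalGenerating {G : Set (invGL n r)} (hG : IsHomogeneousSet G)
    (hmin : IsMinimalGenerating G) :
    LinearIndepOn ℂ (cot (invEval (n := n) (r := r) 0)) G := by
  have h0 := linearIndepOn_empty ℂ (cot (invEval (n := n) (r := r) 0))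
  have hsub := h0.extend_subset (Set.empty_subset G)
  have hb := adjoin_eq_top_of_span_cot (fun s hs => hG s (hsub hs))
    ((h0.span_image_extend_eq_span_image (Set.empty_subset G)).trans
      (span_cot_eq_top _ hmin.prop))
  exact (h0.linearIndepOn_extend (Set.empty_subset G)).mono (hmin.2 hb hsub)

end TraceInv
-- Determinants and traces of powers modulo decomposables
namespace TraceInv

open MvPolynomial

variable {n r : ℕ}

theorem eval_mul_of_isWeightedHomogeneous {σ M R : Type*} [AddCommMonoid M] [CommRing R] {w : σ → M}
    (χ : Multiplicative M →* R) {p : MvPolynomial σ R} {m : M} (hp : IsWeightedHomogeneous w p m)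
    (x : σ → R) :
    eval (fun i => χ (Multiplicative.ofAdd (w i)) * x i) p =
      χ (Multiplicative.ofAdd m) * eval x p := by
  rw [eval_eq, eval_eq, Finset.mul_sum]
  refine Finset.sum_congr rfl fun d hd => ?_
  rw [← hp (mem_support_iff.1 hd), Finsupp.weight_apply, Finsupp.sum, ofAdd_sum, map_prod]
  simp only [mul_pow, Finset.prod_mul_distrib, ofAdd_nsmul, map_pow]
  ring

theorem evalAt_smul_of_isHomogeneous (c : ℂ) {p : PolyRing n r} {m : ℕ} (hp : p.IsHomogeneous m)
    (A : Fin r → Matrix (Fin n) (Fin n) ℂ) : evalAt (c • A) p = c ^ m * evalAt A p := by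
  have h := eval_mul_of_isWeightedHomogeneous (powersHom ℂ c) hp fun x => A x.1 x.2.1 x.2.2
  rw [evalAt_eq_eval, evalAt_eq_eval]
  simpa [powersHom_apply] using h

theorem mapMatrix_genericMatrix (A : Fin r → Matrix (Fin n) (Fin n) ℂ) (k : Fin r) :
    (genericMatrix n r k).map (evalAt A) = A k := by
  ext i j
  simp [genericMatrix, evalAt]

theorem evalAt_charpoly_coeff (A : Fin r → Matrix (Fin n) (Fin n) ℂ) (k : Fin r) (i : ℕ) :
    evalAt A ((genericMatrix n r k).charpoly.coeff i) = (A k).charpoly.coeff i := by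
  have h := Matrix.charpoly_map (genericMatrix n r k) (evalAt A : PolyRing n r →+* ℂ)
  have h' : (genericMatrix n r k).map (evalAt A : PolyRing n r →+* ℂ) = A k :=
    mapMatrix_genericMatrix A k
  rw [h'] at h
  rw [h, Polynomial.coeff_map]
  rfl

theorem evalAt_det (A : Fin r → Matrix (Fin n) (Fin n) ℂ) (k : Fin r) :
    evalAt A (genericMatrix n r k).det = (A k).det := by
  rw [← mapMatrix_genericMatrix A k]
  exact (AlgHom.map_det _ _)

/-- The coefficients of the characteristic polynomial of a generic matrix, as invariants. -/
noncomputable def charInv (n : ℕ) {r : ℕ} (k : Fin r) (i : ℕ) : invGL n r :=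
  ⟨(genericMatrix n r k).charpoly.coeff i, fun g A => by
    rw [evalAt_charpoly_coeff, evalAt_charpoly_coeff, Matrix.coe_units_inv,
      Matrix.charpoly_units_conj]⟩

/-- The determinant of a generic matrix, as an invariant. -/
noncomputable def detInv (n : ℕ) {r : ℕ} (k : Fin r) : invGL n r :=
  ⟨(genericMatrix n r k).det, fun g A => by
    rw [evalAt_det, evalAt_det, Matrix.det_units_conj]⟩

theorem detInv_eq (k : Fin r) : detInv n k = ((-1 : ℂ) ^ n) • charInv n k 0 := by
  apply Subtype.ext
  change (genericMatrix n r k).det = ((-1 : ℂ) ^ n) • (genericMatrix n r k).charpoly.coeff 0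
  rw [Matrix.det_eq_sign_charpoly_coeff, Fintype.card_fin, smul_eq_C_mul, C_pow, C_neg, C_1]

theorem isWeightedHomogeneous_det {M : Type*} [AddCommMonoid M] (ω : Fin r → M) (k : Fin r) :
    IsWeightedHomogeneous (fun x : Fin r × Fin n × Fin n => ω x.1) (genericMatrix n r k).det
      (n • ω k) := by
  rw [Matrix.det_apply]
  refine IsWeightedHomogeneous.sum _ _ _ fun σ _ => ?_
  have h : IsWeightedHomogeneous (fun x : Fin r × Fin n × Fin n => ω x.1)
      (∏ i, genericMatrix n r k (σ i) i) (n • ω k) := by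
    have := IsWeightedHomogeneous.prod Finset.univ (fun i => genericMatrix n r k (σ i) i)
      (fun _ => ω k) fun i _ => isWeightedHomogeneous_X ℂ
        (fun x : Fin r × Fin n × Fin n => ω x.1) (k, σ i, i)
    simpa using this
  rcases Int.units_eq_one_or (Equiv.Perm.sign σ) with h1 | h1
  · rw [h1, one_smul]
    exact h
  · rw [h1, Units.neg_smul, one_smul]
    exact h.neg

theorem isHomogeneous_detInv (k : Fin r) : (detInv n k : PolyRing n r).IsHomogeneous n := by
  have h := isWeightedHomogeneous_det (n := n) (fun _ : Fin r => 1) k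
  rwa [smul_eq_mul, mul_one] at h

theorem isHomogeneous_traceWord (w : List (Fin r)) :
    (traceWord n w).IsHomogeneous w.length := by
  have h : ∀ i j, ((w.map (genericMatrix n r)).prod i j).IsHomogeneous w.length := by
    induction w with
    | nil =>
      intro i j
      rw [List.map_nil, List.prod_nil, Matrix.one_apply]
      split_ifs
      · exact isHomogeneous_one _ _
      · exact isHomogeneous_zero _ _ _
    | cons k w ih =>
      intro i j
      rw [List.map_cons, List.prod_cons, Matrix.mul_apply, List.length_cons, add_comm]
      exact IsHomogeneous.sum _ _ _ fun l _ => (isHomogeneous_X ℂ (k, i, l)).mul (ih l j)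
  exact IsHomogeneous.sum _ _ _ fun i _ => h i i

theorem sum_charInv_mul_traceInv (k : Fin r) :
    ∑ i ∈ Finset.range (n + 1), charInv n k i * traceInv n (List.replicate i k) = 0 := by
  apply Subtype.ext
  rw [AddSubmonoidClass.coe_finsetSum]
  have h := congrArg Matrix.trace (Matrix.aeval_self_charpoly (genericMatrix n r k))
  have hnt : Nontrivial (PolyRing n r) := inferInstance
  rw [Polynomial.aeval_eq_sum_range, Matrix.charpoly_natDegree_eq_dim, Fintype.card_fin,
    Matrix.trace_sum, Matrix.trace_zero] at h
  refine Eq.trans (Finset.sum_congr rfl fun i _ => ?_) h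
  rw [Matrix.trace_smul]
  simp [charInv, traceInv, traceWord]

theorem invEval_zero_of_isHomogeneous {m : ℕ} (hm : m ≠ 0) {p : invGL n r}
    (hp : (p : PolyRing n r).IsHomogeneous m) : invEval 0 p = 0 := by
  rw [invEval_apply, evalAt_zero]
  exact hp.coeff_eq_zero (by simpa using hm.symm)

/-- Differentiate the trace of Cayley–Hamilton at 0. For 0 < i < n both factors of the i-th term
vanish at 0, so only the constant coefficient, which is ±det, and tr(X_k^n) survive. -/
theorem cot_powerTrace_mem (hn : 1 ≤ n) (k : Fin r) :
    cot (invEval (n := n) (r := r) 0) (traceInv n (List.replicate n k)) ∈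
      Submodule.span ℂ {cot (invEval (n := n) (r := r) 0) (detInv n k)} := by
  set d := cot (invEval (n := n) (r := r) 0) with hd
  have hchar : ∀ i, invEval (n := n) (r := r) 0 (charInv n k i) = if i = n then 1 else 0 := by
    intro i
    refine (evalAt_charpoly_coeff 0 k i).trans ?_
    rw [Pi.zero_apply, Matrix.charpoly_zero, Fintype.card_fin, Polynomial.coeff_X_pow]
  have htr : ∀ i, i ≠ 0 → invEval (n := n) (r := r) 0 (traceInv n (List.replicate i k)) = 0 :=
    fun i hi => invEval_zero_of_isHomogeneous (m := i) hi (by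
      simpa [traceInv] using isHomogeneous_traceWord (n := n) (List.replicate i k))
  have hone : charInv n k n = 1 := by
    apply Subtype.ext
    change (genericMatrix n r k).charpoly.coeff n = 1
    have := (Matrix.charpoly_monic (genericMatrix n r k)).coeff_natDegree
    rwa [Matrix.charpoly_natDegree_eq_dim, Fintype.card_fin] at this
  have h := congrArg d (sum_charInv_mul_traceInv (n := n) k)
  rw [map_zero, map_sum, Finset.sum_range_succ, Finset.sum_eq_single 0, hone, one_mul,
    hd, cot_mul, hchar, if_neg (by omega), zero_smul, zero_add, ← hd] at h
  · rw [eq_neg_of_add_eq_zero_right h]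
    refine neg_mem (Submodule.smul_mem _ _ ?_)
    have h2 : charInv n k 0 = ((-1 : ℂ) ^ n) • detInv n k := by
      rw [detInv_eq, smul_smul, ← mul_pow, neg_mul_neg, one_mul, one_pow, one_smul]
    rw [h2, map_smul]
    exact Submodule.smul_mem _ _ (Submodule.mem_span_singleton_self _)
  · intro i hi hi0
    rw [hd, cot_mul, hchar, if_neg (by simp at hi; omega), htr i hi0, zero_smul, zero_smul,
      add_zero]
  · intro h0
    simp at h0
    omega

/-- D is the cyclic shift and g = diag(ξ^i) for a primitive n-th root of unity ξ. The entry at (i,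
i+1) is scaled by ξ^i ξ^{-(i+1)} = ξ⁻¹, also at the wrap-around because ξ^n = 1. -/
theorem exists_conj_eq_smul (hn : 1 ≤ n) : ∃ (D : Matrix (Fin n) (Fin n) ℂ) (ζ : ℂ)
    (g : GL (Fin n) ℂ), IsPrimitiveRoot ζ n ∧ D.det ≠ 0 ∧
      (g : Matrix (Fin n) (Fin n) ℂ) * D * ((g⁻¹ : GL (Fin n) ℂ) : Matrix (Fin n) (Fin n) ℂ) =
        ζ • D := by
  have : NeZero n := ⟨by omega⟩
  obtain ⟨ξ, hξ⟩ : ∃ ξ : ℂ, IsPrimitiveRoot ξ n := ⟨_, Complex.isPrimitiveRoot_exp n (by omega)⟩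
  have hξ0 : ξ ≠ 0 := hξ.ne_zero (by omega)
  let σ : Equiv.Perm (Fin n) := Equiv.addRight 1
  let g : GL (Fin n) ℂ :=
    ⟨Matrix.diagonal fun i => ξ ^ (i : ℕ), Matrix.diagonal fun i => (ξ ^ (i : ℕ))⁻¹,
      by simp [hξ0], by simp [hξ0]⟩
  refine ⟨σ.permMatrix ℂ, ξ⁻¹, g, hξ.inv, ?_, ?_⟩
  · rw [Matrix.det_permutation]
    rcases Int.units_eq_one_or (Equiv.Perm.sign σ) with h | h <;> rw [h] <;> simp
  · change Matrix.diagonal (fun i : Fin n => ξ ^ (i : ℕ)) * σ.permMatrix ℂ *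
      Matrix.diagonal (fun i : Fin n => (ξ ^ (i : ℕ))⁻¹) = _
    ext i j
    rw [Matrix.mul_diagonal, Matrix.diagonal_mul, Matrix.smul_apply, smul_eq_mul,
      Equiv.Perm.permMatrix, PEquiv.toMatrix_apply]
    by_cases hij : j ∈ σ.toPEquiv i
    · have hj : j = i + 1 := by simpa [σ, eq_comm] using hij
      rw [if_pos hij, hj, Fin.val_add, ← pow_eq_pow_mod _ hξ.pow_eq_one, pow_add, Fin.val_one',
        ← pow_eq_pow_mod _ hξ.pow_eq_one, pow_one]
      field_simp
    · rw [if_neg hij]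
      simp

/-- The matrix tuple with `D` in position `k` and zeros elsewhere. -/
def singlePoint (D : Matrix (Fin n) (Fin n) ℂ) (k : Fin r) : Fin r → Matrix (Fin n) (Fin n) ℂ :=
  Pi.single k D

/-- There are linear functionals on the invariants, vanishing on decomposables, dual to the
determinants and vanishing on traces of words that are not `n`-th powers of a generic matrix. -/
theorem exists_dual_det (hn : 1 ≤ n) : ∃ φ : Fin r → invGL n r →ₗ[ℂ] ℂ,
    (∀ k, ∀ x ∈ decomposables (invEval (n := n) (r := r) 0), φ k x = 0) ∧
    (∀ k, φ k (detInv n k) ≠ 0) ∧ (∀ k j, j ≠ k → φ k (detInv n j) = 0) ∧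
    (∀ k w, traceInv n w ∉ powerTraces n r → φ k (traceInv n w) = 0) := by
  obtain ⟨D, ζ, g, hζ, hD, hg⟩ := exists_conj_eq_smul hn
  -- An invariant of degree m takes the same value at D and at ζD, so that value equals ζ^m times
  -- itself; here ζ^m ≠ 1.
  have hlow : ∀ k, ∀ m, m ≠ 0 → m < n → ∀ p : invGL n r,
      invEval (singlePoint D k) (invComponent n r m p) = 0 := by
    intro k m hm hmn p
    have h1 := (invComponent n r m p).2 g (singlePoint D k)
    have h2 : (fun j => (g : Matrix (Fin n) (Fin n) ℂ) * (singlePoint D k : Fin r → _) j *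
        ((g⁻¹ : GL (Fin n) ℂ) : Matrix (Fin n) (Fin n) ℂ)) = ζ • singlePoint D k := by
      funext j
      by_cases hj : j = k
      · subst hj
        simpa [singlePoint] using hg
      · simp [singlePoint, hj]
    rw [h2, evalAt_smul_of_isHomogeneous ζ (invComponent_isHomogeneous m p)] at h1
    rw [invEval_apply]
    by_contra h0
    exact hζ.pow_ne_one_of_pos_of_lt hm hmn (mul_right_cancel₀ h0 (h1.trans (one_mul _).symm))
  -- The functional evaluates the degree-n part at D in slot k. By `hlow` it kills products of two
  -- factors of positive degree.
  refine ⟨fun k => (invEval (singlePoint D k)).toLinearMap.comp (invComponent n r n),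
    fun k x hx => ?_, fun k => ?_, fun k j hj => ?_, fun k w hw => ?_⟩
  · suffices h : decomposables (invEval (n := n) (r := r) 0) ≤
        LinearMap.ker ((invEval (singlePoint D k)).toLinearMap.comp (invComponent n r n)) from h hx
    refine Submodule.span_le.2 ?_
    rintro x (rfl | ⟨a, b, ha, hb, rfl⟩)
    · change invEval (singlePoint D k) (invComponent n r n 1) = 0
      rw [invComponent_of_isHomogeneous (isHomogeneous_one _ _), if_neg (by omega), map_zero]
    · change invEval (singlePoint D k) (invComponent n r n (a * b)) = 0
      rw [invComponent_mul, map_sum]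
      refine Finset.sum_eq_zero fun i _ => ?_
      rw [map_sum]
      refine Finset.sum_eq_zero fun j _ => ?_
      split_ifs with hij
      · rcases Nat.eq_zero_or_pos i with rfl | hi
        · rw [invComponent_zero, ha, map_zero, zero_mul, map_zero]
        rcases Nat.eq_zero_or_pos j with rfl | hj
        · rw [invComponent_zero b, hb, map_zero, mul_zero, map_zero]
        rw [map_mul, hlow k i (by omega) (by omega), zero_mul]
      · exact map_zero _
  · change invEval (singlePoint D k) (invComponent n r n (detInv n k)) ≠ 0
    rw [invComponent_of_isHomogeneous (isHomogeneous_detInv k), if_pos rfl]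
    refine (evalAt_det _ _).trans_ne ?_
    simpa [singlePoint] using hD
  · change invEval (singlePoint D k) (invComponent n r n (detInv n j)) = 0
    rw [invComponent_of_isHomogeneous (isHomogeneous_detInv j), if_pos rfl]
    refine (evalAt_det _ _).trans ?_
    have : Nonempty (Fin n) := ⟨⟨0, hn⟩⟩
    simp [singlePoint, hj]
  · change invEval (singlePoint D k) (invComponent n r n (traceInv n w)) = 0
    rw [invComponent_of_isHomogeneous (isHomogeneous_traceWord w)]
    split_ifs with hlen
    · refine (evalAt_traceWord _ _).trans ?_
      -- A word of length n that is not a power of X_k contains a letter evaluated at 0.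
      have hex : ∃ j ∈ w, j ≠ k := by
        by_contra! hall
        refine hw ⟨k, ?_⟩
        change traceInv n (List.replicate n k) = _
        rw [List.eq_replicate_iff.2 ⟨hlen.symm, hall⟩]
      obtain ⟨j, hjw, hjk⟩ := hex
      rw [List.prod_eq_zero (List.mem_map.2 ⟨j, hjw, by simp [singlePoint, hjk]⟩),
        Matrix.trace_zero]
    · exact map_zero _

end TraceInv
-- Translation of the base point from 0 to the identity
namespace TraceInv

open MvPolynomial

variable {n r : ℕ}

section Translation

variable {σ R : Type*} [CommRing R]

theorem mul_X_add_C_mem_restrictSupport {m : ℕ} {q : MvPolynomial σ R} (c : R) (i : σ)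
    (hq : q ∈ restrictSupport R {d : σ →₀ ℕ | d.degree < m}) :
    q * (X i + C c) ∈ restrictSupport R {d : σ →₀ ℕ | d.degree < m + 1} := by
  rw [mem_restrictSupport_iff] at hq
  rw [mul_add]
  refine add_mem ?_ ?_
  · rw [mem_restrictSupport_iff, support_mul_X]
    intro d hd
    obtain ⟨e, he, rfl⟩ := Finset.mem_map.1 hd
    have := hq he
    simp only [Set.mem_ofPred_eq, addRightEmbedding_apply, map_add, Finsupp.degree_single] at this ⊢
    omega
  · rw [mem_restrictSupport_iff]
    intro d hd
    rw [Finset.mem_coe, mem_support_iff, mul_comm, coeff_C_mul] at hd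
    have := hq (mem_support_iff.2 (right_ne_zero_of_mul hd))
    simp only [Set.mem_ofPred_eq] at this ⊢
    omega

theorem aeval_X_add_C_monomial_sub_mem (c : σ → R) (s : σ →₀ ℕ) :
    aeval (fun i => X i + C (c i)) (monomial s (1 : R)) - monomial s 1 ∈
      restrictSupport R {d : σ →₀ ℕ | d.degree < s.degree} := by
  classical
  suffices h : ∀ (m : ℕ) (s : σ →₀ ℕ), s.degree = m →
      aeval (fun i => X i + C (c i)) (monomial s (1 : R)) - monomial s 1 ∈
        restrictSupport R {d : σ →₀ ℕ | d.degree < m} from h _ s rfl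
  intro m
  induction m with
  | zero =>
    intro s hs
    rw [(Finsupp.degree_eq_zero_iff s).1 hs]
    simp
  | succ m ih =>
    intro s hs
    obtain ⟨i, hi⟩ : ∃ i, s i ≠ 0 := by
      by_contra! h
      rw [show s = 0 from Finsupp.ext h] at hs
      simp at hs
    obtain ⟨s, rfl⟩ : ∃ s', s = s' + Finsupp.single i 1 :=
      ⟨s - Finsupp.single i 1, (tsub_add_cancel_of_le
        (Finsupp.single_le_iff.2 (Nat.one_le_iff_ne_zero.2 hi))).symm⟩
    have hs' : s.degree = m := by
      rw [map_add, Finsupp.degree_single] at hs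
      omega
    have hmon : monomial (s + Finsupp.single i 1) (1 : R) = monomial s 1 * X i := by
      rw [X, monomial_mul, one_mul]
    rw [hmon, map_mul, aeval_X]
    have hsplit : aeval (fun i => X i + C (c i)) (monomial s (1 : R)) * (X i + C (c i)) -
        monomial s 1 * X i =
        (aeval (fun i => X i + C (c i)) (monomial s (1 : R)) - monomial s 1) * (X i + C (c i)) +
          c i • monomial s 1 := by
      rw [smul_eq_C_mul]
      ring
    rw [hsplit]
    refine add_mem (mul_X_add_C_mem_restrictSupport _ _ (ih s hs')) (Submodule.smul_mem _ _ ?_)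
    rw [mem_restrictSupport_iff]
    intro d hd
    rw [Finset.mem_singleton.1 (support_monomial_subset hd)]
    change s.degree < m + 1
    omega

/-- Translation changes a form only in strictly lower degrees; by linearity this reduces to
monomials. -/
theorem aeval_X_add_C_sub_mem (c : σ → R) {p : MvPolynomial σ R} {m : ℕ} (hp : p.IsHomogeneous m) :
    aeval (fun i => X i + C (c i)) p - p ∈ restrictSupport R {d : σ →₀ ℕ | d.degree < m} := by
  rw [← support_sum_monomial_coeff p, map_sum, ← Finset.sum_sub_distrib]
  refine sum_mem fun s hs => ?_
  have hm : s.degree = m := by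
    by_contra h
    exact mem_support_iff.1 hs (hp.coeff_eq_zero h)
  have h : monomial s (coeff s p) = coeff s p • monomial s (1 : R) := by
    rw [smul_monomial, smul_eq_mul, mul_one]
  rw [h, map_smul, ← smul_sub, ← hm]
  exact Submodule.smul_mem _ _ (aeval_X_add_C_monomial_sub_mem c s)

theorem homogeneousComponent_aeval_X_add_C (c : σ → R) {p : MvPolynomial σ R} {m j : ℕ}
    (hp : p.IsHomogeneous m) (hj : m ≤ j) :
    homogeneousComponent j (aeval (fun i => X i + C (c i)) p) = homogeneousComponent j p := by
  rw [← sub_eq_zero, ← map_sub]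
  refine homogeneousComponent_eq_zero' j _ fun d hd => ?_
  have := (mem_restrictSupport_iff R).1 (aeval_X_add_C_sub_mem c hp) hd
  simp only [Set.mem_ofPred_eq] at this
  omega

end Translation

theorem evalAt_translation (A : Fin r → Matrix (Fin n) (Fin n) ℂ) (p : PolyRing n r) :
    evalAt A (aeval (fun x => X x + C ((1 : Matrix (Fin n) (Fin n) ℂ) x.2.1 x.2.2)) p) =
      evalAt (A + 1) p := by
  have : (evalAt A).comp (aeval fun x => X x + C ((1 : Matrix (Fin n) (Fin n) ℂ) x.2.1 x.2.2)) =
      evalAt (A + 1) := by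
    ext ⟨k, i, j⟩
    simp [evalAt]
  exact DFunLike.congr_fun this p

/-- Substitution of `X_k + 1` for `X_k`, on invariants. -/
noncomputable def translation (n r : ℕ) : invGL n r →ₐ[ℂ] invGL n r :=
  ((aeval fun x => X x + C ((1 : Matrix (Fin n) (Fin n) ℂ) x.2.1 x.2.2)).comp
    (invGL n r).val).codRestrict (invGL n r) fun p g A => by
      have h := p.2 g (A + 1)
      have h2 : (fun k => (g : Matrix (Fin n) (Fin n) ℂ) * (A + 1) k *
          ((g⁻¹ : GL (Fin n) ℂ) : Matrix (Fin n) (Fin n) ℂ)) =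
          (fun k => (g : Matrix (Fin n) (Fin n) ℂ) * A k *
          ((g⁻¹ : GL (Fin n) ℂ) : Matrix (Fin n) (Fin n) ℂ)) + 1 := by
        funext k
        rw [Pi.add_apply, Pi.add_apply, Pi.one_apply, Matrix.mul_add, Matrix.add_mul, mul_one,
          Units.mul_inv]
      rw [h2] at h
      exact (evalAt_translation _ _).trans (h.trans (evalAt_translation _ _).symm)

theorem invEval_zero_translation (p : invGL n r) :
    invEval 0 (translation n r p) = invEval 1 p := by
  refine (evalAt_translation _ _).trans ?_
  rw [zero_add]
  rfl

theorem invComponent_translation {p : invGL n r} {m j : ℕ}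
    (hp : (p : PolyRing n r).IsHomogeneous m) (hj : m ≤ j) :
    invComponent n r j (translation n r p) = invComponent n r j p :=
  Subtype.ext (homogeneousComponent_aeval_X_add_C _ hp hj)

theorem invEval_zero_invComponent {p : invGL n r} (hp : invEval 0 p = 0) (m : ℕ) :
    invEval 0 (invComponent n r m p) = 0 := by
  rcases eq_or_ne m 0 with rfl | hm
  · rw [invComponent_zero, hp, map_zero, map_zero]
  · exact invEval_zero_of_isHomogeneous hm (invComponent_isHomogeneous m p)

theorem invComponent_mem_decomposables (m : ℕ) {x : invGL n r}
    (hx : x ∈ decomposables (invEval (n := n) (r := r) 0)) :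
    invComponent n r m x ∈ decomposables (invEval (n := n) (r := r) 0) := by
  suffices h : decomposables (invEval (n := n) (r := r) 0) ≤
      (decomposables (invEval (n := n) (r := r) 0)).comap (invComponent n r m) from h hx
  refine Submodule.span_le.2 ?_
  rintro x (rfl | ⟨a, b, ha, hb, rfl⟩)
  · change invComponent n r m 1 ∈ decomposables (invEval (n := n) (r := r) 0)
    rw [invComponent_of_isHomogeneous (isHomogeneous_one _ _)]
    split_ifs
    · exact one_mem_decomposables _
    · exact zero_mem _
  · change invComponent n r m (a * b) ∈ decomposables (invEval (n := n) (r := r) 0)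
    rw [invComponent_mul]
    refine sum_mem fun i _ => sum_mem fun j _ => ?_
    split_ifs
    · exact mul_mem_decomposables _ (invEval_zero_invComponent ha i)
        (invEval_zero_invComponent hb j)
    · exact zero_mem _

/-- Translation carries a relation at 1 to one at 0. Its component in the largest degree occurring
with nonzero coefficient is untouched by translation, and so is a relation at 0 among elements of H.
-/
theorem linearIndepOn_cot_one {H : Set (invGL n r)} (hH : IsHomogeneousSet H)
    (hli : LinearIndepOn ℂ (cot (invEval (n := n) (r := r) 0)) H) :
    LinearIndepOn ℂ (cot (invEval (n := n) (r := r) 1)) H := by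
  classical
  choose! deg hdeg using hH
  rw [linearIndepOn_iff'] at hli ⊢
  intro t c ht hsum
  by_contra! hne
  obtain ⟨i₀, hi₀, hc₀⟩ := hne
  obtain ⟨i₁, hi₁, hmax⟩ := Finset.exists_max_image (t.filter fun i => c i ≠ 0) deg
    ⟨i₀, Finset.mem_filter.2 ⟨hi₀, hc₀⟩⟩
  obtain ⟨hi₁t, hc₁⟩ := Finset.mem_filter.1 hi₁
  have hmem : ∑ i ∈ t, c i • i ∈ decomposables (invEval (n := n) (r := r) 1) := by
    rw [← cot_eq_zero]
    simpa using hsum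
  have h2 := invComponent_mem_decomposables (deg i₁)
    (map_mem_decomposables _ _ (translation n r) invEval_zero_translation hmem)
  rw [map_sum, map_sum, ← cot_eq_zero, map_sum] at h2
  have h3 := hli (t.filter fun i => deg i = deg i₁) c
    (fun i hi => ht (Finset.mem_filter.1 hi).1) (by
      rw [Finset.sum_filter]
      refine Eq.trans (Finset.sum_congr rfl fun i hi => ?_) h2
      rw [map_smul, map_smul, map_smul]
      by_cases hci : c i = 0
      · simp [hci]
      have hle := hmax i (Finset.mem_filter.2 ⟨hi, hci⟩)
      rw [invComponent_translation (hdeg i (ht hi)) hle,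
        invComponent_of_isHomogeneous (hdeg i (ht hi))]
      by_cases hd : deg i = deg i₁
      · rw [if_pos hd, if_pos hd.symm]
      · rw [if_neg hd, if_neg (Ne.symm hd), map_zero, smul_zero])
    i₁ (Finset.mem_filter.2 ⟨hi₁t, rfl⟩)
  exact hc₁ h3

end TraceInv
-- Restriction to SL(n)^r: surjectivity and kernel
namespace TraceInv

open MvPolynomial

variable {n r : ℕ}

/-- The weights that give the multidegree: the degrees in the entries of each generic matrix. -/
abbrev multiWeight (n r : ℕ) (x : Fin r × Fin n × Fin n) : Fin r → ℕ := Pi.single x.1 1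

/-- The component of multidegree `m`. -/
noncomputable abbrev multiComponent (m : Fin r → ℕ) : PolyRing n r →ₗ[ℂ] PolyRing n r :=
  weightedHomogeneousComponent (multiWeight n r) m

theorem evalAt_smul_of_isWeightedHomogeneous (c : Fin r → ℂ) {p : PolyRing n r} {m : Fin r → ℕ}
    (hp : IsWeightedHomogeneous (multiWeight n r) p m) (A : Fin r → Matrix (Fin n) (Fin n) ℂ) :
    evalAt (fun k => c k • A k) p = (∏ k, c k ^ m k) * evalAt A p := by
  let χ : Multiplicative (Fin r → ℕ) →* ℂ :=
    { toFun := fun m => ∏ k, c k ^ (m.toAdd k)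
      map_one' := by simp
      map_mul' := fun a b => by simp [pow_add, Finset.prod_mul_distrib] }
  have h := eval_mul_of_isWeightedHomogeneous χ hp fun x => A x.1 x.2.1 x.2.2
  have hχ : ∀ k : Fin r, χ (Multiplicative.ofAdd (Pi.single k 1)) = c k := fun k => by
    change ∏ j, c j ^ ((Pi.single k 1 : Fin r → ℕ) j) = c k
    rw [Finset.prod_eq_single k]
    · simp
    · intro j _ hj
      simp [hj]
    · simp
  simp only [multiWeight, hχ] at h
  rw [evalAt_eq_eval, evalAt_eq_eval]
  exact h

/-- The multidegrees of the monomials of `p`. -/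
noncomputable def multidegrees (p : PolyRing n r) : Finset (Fin r → ℕ) :=
  p.support.image (Finsupp.weight (multiWeight n r))

theorem multiComponent_eq_zero {p : PolyRing n r} {m : Fin r → ℕ} (hm : m ∉ multidegrees p) :
    multiComponent m p = 0 :=
  weightedHomogeneousComponent_eq_zero' m p fun d hd h =>
    hm (Finset.mem_image.2 ⟨d, hd, h⟩)

theorem sum_multiComponent (p : PolyRing n r) :
    ∑ m ∈ multidegrees p, multiComponent m p = p := by
  conv_rhs => rw [← sum_weightedHomogeneousComponent (multiWeight n r) p]
  refine (finsum_eq_sum_of_support_subset _ fun m hm => ?_).symm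
  by_contra h
  exact hm (multiComponent_eq_zero h)

/-- Scaling each A_k by an n-th root of unity stays in SL(n). Multidegrees in a cube of side n give
distinct characters of μ_n^r, so the components vanish separately. -/
theorem evalAt_multiComponent_eq_zero (hn : 1 ≤ n) {q : PolyRing n r} (hq : restrictSL n r q = 0)
    {N : ℕ} (hN : ∀ m, multiComponent m q ≠ 0 → ∀ k, n * N ≤ m k ∧ m k < n * N + n)
    (A : Fin r → SL(n, ℂ)) (m : Fin r → ℕ) :
    evalAt (fun k => (A k : Matrix (Fin n) (Fin n) ℂ)) (multiComponent m q) = 0 := by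
  classical
  by_contra hne
  set e : (Fin r → ℕ) → ℂ :=
    fun m => evalAt (fun k => (A k : Matrix (Fin n) (Fin n) ℂ)) (multiComponent m q) with he
  have hrange : ∀ m, e m ≠ 0 → ∀ k, n * N ≤ m k ∧ m k < n * N + n := fun m hm =>
    hN m fun h => hm (by rw [he]; simp only [h, map_zero])
  -- Subtracting n * N leaves powers of n-th roots of unity unchanged and brings the relevant
  -- exponents below n, so vanishing on the grid μ_n^r forces Q = 0.
  let shift : (Fin r → ℕ) → (Fin r →₀ ℕ) := fun m => Finsupp.equivFunOnFinite.symm fun k =>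
    m k - n * N
  let Q : MvPolynomial (Fin r) ℂ := ∑ m ∈ multidegrees q, monomial (shift m) (e m)
  have hQ : Q = 0 := by
    refine eq_zero_of_eval_zero_at_prod_finset Q (fun _ => Polynomial.nthRootsFinset n 1)
      (fun k => ?_) fun ζ hζ => ?_
    · rw [(Complex.isPrimitiveRoot_exp n (by omega)).card_nthRootsFinset,
        degreeOf_lt_iff (by omega)]
      intro d hd
      rw [mem_support_iff, coeff_sum] at hd
      obtain ⟨m, -, hm⟩ := Finset.exists_ne_zero_of_sum_ne_zero hd
      rw [coeff_monomial] at hm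
      split_ifs at hm with h
      · rw [← h]
        change m k - n * N < n
        have := hrange m hm k
        omega
      · exact absurd rfl hm
    · have hζ' : ∀ k, ζ k ^ n = 1 := fun k =>
        (Polynomial.mem_nthRootsFinset (by omega) _).1 (hζ k)
      let B : Fin r → SL(n, ℂ) := fun k => ⟨ζ k • (A k : Matrix (Fin n) (Fin n) ℂ), by
        rw [Matrix.det_smul, Fintype.card_fin, hζ' k, (A k).2, one_mul]⟩
      have hB : evalAt (fun k => ζ k • (A k : Matrix (Fin n) (Fin n) ℂ)) q = 0 := congrFun hq B
      rw [← sum_multiComponent q, map_sum] at hB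
      rw [map_sum]
      refine Eq.trans (Finset.sum_congr rfl fun m _ => ?_) hB
      rw [evalAt_smul_of_isWeightedHomogeneous ζ
        (weightedHomogeneousComponent_isWeightedHomogeneous m q), eval_monomial]
      change e m * _ = _ * e m
      rw [mul_comm]
      -- If e m ≠ 0, the cube bound makes the truncated subtraction exact; otherwise both sides
      -- vanish.
      rcases eq_or_ne (e m) 0 with h0 | h0
      · rw [h0, mul_zero, mul_zero]
      congr 1
      rw [Finsupp.prod_fintype _ _ fun _ => pow_zero _]
      refine Finset.prod_congr rfl fun k _ => ?_
      change ζ k ^ (m k - n * N) = ζ k ^ m k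
      have hk := (hrange m h0 k).1
      conv_rhs => rw [← Nat.sub_add_cancel hk, pow_add, pow_mul, hζ' k, one_pow, mul_one]
  have hcoeff : coeff (shift m) Q = e m := by
    rw [coeff_sum, Finset.sum_eq_single m]
    · rw [coeff_monomial, if_pos rfl]
    · intro m' _ hm'
      rw [coeff_monomial]
      split_ifs with h
      · by_contra h0
        refine hm' (funext fun k => ?_)
        have h1 : m' k - n * N = m k - n * N := DFunLike.congr_fun h k
        have h2 := hrange m' h0 k
        have h3 := hrange m hne k
        omega
      · rfl
    · intro hm
      rw [coeff_monomial, if_pos rfl]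
      simp only [he, multiComponent_eq_zero hm, map_zero]
  rw [hQ, coeff_zero] at hcoeff
  exact hne hcoeff.symm

theorem prod_det_ne_zero : ∏ k, (genericMatrix n r k).det ≠ 0 := by
  intro h
  have := congrArg (evalAt (1 : Fin r → Matrix (Fin n) (Fin n) ℂ)) h
  rw [map_prod, map_zero, Finset.prod_eq_one] at this
  · exact one_ne_zero this
  · intro k _
    rw [evalAt_det, Pi.one_apply, Matrix.det_one]

/-- A polynomial vanishing on `SL(n)^r` is zero if its multidegrees are distinct modulo `n`, in the
sense that they lie in a cube of side `n`. -/
theorem eq_zero_of_restrictSL_eq_zero (hn : 1 ≤ n) {q : PolyRing n r} (hq : restrictSL n r q = 0)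
    {N : ℕ} (hN : ∀ m, multiComponent m q ≠ 0 → ∀ k, n * N ≤ m k ∧ m k < n * N + n) : q = 0 := by
  -- An invertible matrix is a scalar times an element of SL(n), and each multidegree component is
  -- homogeneous under such scalings.
  have hGL : ∀ A : Fin r → Matrix (Fin n) (Fin n) ℂ, (∀ k, (A k).det ≠ 0) → evalAt A q = 0 := by
    intro A hA
    choose c hc using fun k => IsAlgClosed.exists_pow_nat_eq (A k).det (show 0 < n by omega)
    have hc0 : ∀ k, c k ≠ 0 := fun k h => hA k (by rw [← hc k, h, zero_pow (by omega)])
    let B : Fin r → SL(n, ℂ) := fun k => ⟨(c k)⁻¹ • A k, by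
      rw [Matrix.det_smul, Fintype.card_fin, ← hc k, inv_pow,
        inv_mul_cancel₀ (pow_ne_zero n (hc0 k))]⟩
    have hAB : A = fun k => c k • (B k : Matrix (Fin n) (Fin n) ℂ) := funext fun k => by
      change A k = c k • (c k)⁻¹ • A k
      rw [smul_smul, mul_inv_cancel₀ (hc0 k), one_smul]
    rw [← sum_multiComponent q, map_sum]
    refine Finset.sum_eq_zero fun m _ => ?_
    rw [hAB, evalAt_smul_of_isWeightedHomogeneous c
      (weightedHomogeneousComponent_isWeightedHomogeneous m q),
      evalAt_multiComponent_eq_zero hn hq hN B m, mul_zero]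
  have h : q * ∏ k, (genericMatrix n r k).det = 0 := by
    refine ext_evalAt fun A => ?_
    rw [map_mul, map_zero, map_prod]
    by_cases hA : ∀ k, (A k).det ≠ 0
    · rw [hGL A hA, zero_mul]
    · push Not at hA
      obtain ⟨k, hk⟩ := hA
      rw [Finset.prod_eq_zero (Finset.mem_univ k) (by rw [evalAt_det, hk]), mul_zero]
  exact (mul_eq_zero.1 h).resolve_right prod_det_ne_zero

/-- A common bound for the multidegrees of `p`. -/
noncomputable def multidegreeBound (p : PolyRing n r) : ℕ :=
  (multidegrees p).sup fun m => ∑ k, m k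

theorem div_le_multidegreeBound {p : PolyRing n r} {m : Fin r → ℕ} (hm : m ∈ multidegrees p)
    (k : Fin r) : m k / n ≤ multidegreeBound p :=
  (Nat.div_le_self _ _).trans ((Finset.single_le_sum (fun _ _ => Nat.zero_le _)
    (Finset.mem_univ k)).trans (Finset.le_sup (f := fun m : Fin r → ℕ => ∑ k, m k) hm))

/-- The product of determinants that brings multidegree `m` into the cube of side `n` at
`n * N`. -/
noncomputable def detFactor (n : ℕ) {r : ℕ} (N : ℕ) (m : Fin r → ℕ) : invGL n r :=
  ∏ k, detInv n k ^ (N - m k / n)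

theorem coe_detFactor (N : ℕ) (m : Fin r → ℕ) : (detFactor n N m : PolyRing n r) =
    ∏ k, (genericMatrix n r k).det ^ (N - m k / n) := by
  rw [detFactor, SubmonoidClass.coe_finsetProd]
  rfl

theorem restrictSL_apply (p : PolyRing n r) (A : Fin r → SL(n, ℂ)) :
    restrictSL n r p A = evalAt (fun k => (A k : Matrix (Fin n) (Fin n) ℂ)) p := rfl

theorem restrictSL_det (k : Fin r) : restrictSL n r (genericMatrix n r k).det = 1 := by
  funext A
  rw [restrictSL_apply, evalAt_det, (A k).2, Pi.one_apply]

theorem restrictSL_detFactor (N : ℕ) (m : Fin r → ℕ) :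
    restrictSL n r (detFactor n N m : PolyRing n r) = 1 := by
  rw [coe_detFactor, map_prod]
  exact Finset.prod_eq_one fun k _ => by rw [map_pow, restrictSL_det, one_pow]

/-- Homogenization of `p` by determinants, separately in each residue class of multidegrees
modulo `n`. -/
noncomputable def homogenize (p : PolyRing n r) : PolyRing n r :=
  ∑ m ∈ multidegrees p, multiComponent m p * detFactor n (multidegreeBound p) m

theorem restrictSL_homogenize (p : PolyRing n r) :
    restrictSL n r (homogenize p) = restrictSL n r p := by
  conv_rhs => rw [← sum_multiComponent p]
  rw [homogenize, map_sum, map_sum]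
  refine Finset.sum_congr rfl fun m _ => ?_
  rw [map_mul, restrictSL_detFactor, mul_one]

/-- With N the bound, m_k + n(N - ⌊m_k/n⌋) = nN + (m_k mod n); the choice of N prevents truncation.
-/
theorem multidegree_homogenize (hn : 1 ≤ n) (p : PolyRing n r) (m : Fin r → ℕ)
    (hm : multiComponent m (homogenize p) ≠ 0) (k : Fin r) :
    n * multidegreeBound p ≤ m k ∧ m k < n * multidegreeBound p + n := by
  rw [homogenize, map_sum] at hm
  obtain ⟨m', hm', hne⟩ := Finset.exists_ne_zero_of_sum_ne_zero hm
  have hhom : IsWeightedHomogeneous (multiWeight n r)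
      (multiComponent m' p * ((detFactor n (multidegreeBound p) m' : invGL n r) : PolyRing n r))
      (m' + ∑ k, (multidegreeBound p - m' k / n) • n • (Pi.single k 1 : Fin r → ℕ)) := by
    refine (weightedHomogeneousComponent_isWeightedHomogeneous m' p).mul ?_
    rw [coe_detFactor]
    exact IsWeightedHomogeneous.prod _ _ _ fun k _ =>
      (isWeightedHomogeneous_det (fun k : Fin r => (Pi.single k 1 : Fin r → ℕ)) k).pow _
  have hmm : m = m' + ∑ k, (multidegreeBound p - m' k / n) • n • (Pi.single k 1 : Fin r → ℕ) := by
    by_contra h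
    exact hne (hhom.weightedHomogeneousComponent_ne m h)
  have hmk : m k = m' k + (multidegreeBound p - m' k / n) * n := by
    rw [hmm, Pi.add_apply, Finset.sum_apply, Finset.sum_eq_single k]
    · simp
    · intro j _ hj
      simp [hj.symm]
    · simp
  have h1 := div_le_multidegreeBound (n := n) hm' k
  have h2 := Nat.div_add_mod (m' k) n
  have h3 := Nat.mod_lt (m' k) (show 0 < n by omega)
  have h4 : n * (m' k / n) + (multidegreeBound p - m' k / n) * n = n * multidegreeBound p := by
    rw [mul_comm _ n, ← mul_add, Nat.add_sub_cancel' h1]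
  omega

theorem exists_SL_conj (hn : 1 ≤ n) (g : GL (Fin n) ℂ) : ∃ h : SL(n, ℂ),
    ∀ A : SL(n, ℂ), (g : Matrix (Fin n) (Fin n) ℂ) * A *
      ((g⁻¹ : GL (Fin n) ℂ) : Matrix (Fin n) (Fin n) ℂ) = ((h * A * h⁻¹ : SL(n, ℂ)) :
        Matrix (Fin n) (Fin n) ℂ) := by
  obtain ⟨c, hc⟩ := IsAlgClosed.exists_pow_nat_eq (g : Matrix (Fin n) (Fin n) ℂ).det
    (show 0 < n by omega)
  have hg : (g : Matrix (Fin n) (Fin n) ℂ).det ≠ 0 := g.det.ne_zero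
  have hc0 : c ≠ 0 := fun h => hg (by rw [← hc, h, zero_pow (by omega)])
  let h : SL(n, ℂ) := ⟨c⁻¹ • (g : Matrix (Fin n) (Fin n) ℂ), by
    rw [Matrix.det_smul, Fintype.card_fin, ← hc, inv_pow, inv_mul_cancel₀ (pow_ne_zero n hc0)]⟩
  have hh : (h : Matrix (Fin n) (Fin n) ℂ) = c⁻¹ • (g : Matrix (Fin n) (Fin n) ℂ) := rfl
  have hinv : ((h⁻¹ : SL(n, ℂ)) : Matrix (Fin n) (Fin n) ℂ) =
      c • ((g⁻¹ : GL (Fin n) ℂ) : Matrix (Fin n) (Fin n) ℂ) := by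
    refine left_inv_eq_right_inv (a := (h : Matrix (Fin n) (Fin n) ℂ)) ?_ ?_
    · rw [← Matrix.SpecialLinearGroup.coe_mul, inv_mul_cancel, Matrix.SpecialLinearGroup.coe_one]
    · rw [hh, Matrix.smul_mul, Matrix.mul_smul, smul_smul, inv_mul_cancel₀ hc0, one_smul,
        Units.mul_inv]
  refine ⟨h, fun A => ?_⟩
  rw [Matrix.SpecialLinearGroup.coe_mul, Matrix.SpecialLinearGroup.coe_mul, hinv, hh,
    Matrix.smul_mul, Matrix.smul_mul, Matrix.mul_smul, smul_smul, inv_mul_cancel₀ hc0, one_smul]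

/-- The homogenized lift is invariant: its difference with any conjugate vanishes on SL(n)^r and has
multidegrees in the same cube, so it is zero. -/
theorem proj_surjective (hn : 1 ≤ n) : Function.Surjective (proj n r) := by
  rintro ⟨f, ⟨p, hp⟩, hf⟩
  have hq : restrictSL n r (homogenize p) = f := (restrictSL_homogenize p).trans hp
  have hmem : homogenize p ∈ invGL n r := by
    refine mem_invGL_iff.2 fun g => sub_eq_zero.1 ?_
    refine eq_zero_of_restrictSL_eq_zero hn (N := multidegreeBound p) ?_ fun m hm k =>
      multidegree_homogenize hn p m (fun h0 => hm ?_) k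
    · rw [map_sub, hq, sub_eq_zero]
      funext A
      obtain ⟨h, hh⟩ := exists_SL_conj hn g
      rw [restrictSL_apply, evalAt_conjHom, ← hf h A, ← hq, restrictSL_apply]
      simp only [hh]
    · rw [map_sub, h0, sub_zero]
      refine (weightedHomogeneousComponent_conjHom
        (fun k : Fin r => (Pi.single k 1 : Fin r → ℕ)) m g _).symm.trans ?_
      exact (congrArg (conjHom g) h0).trans (map_zero _)
  exact ⟨⟨homogenize p, hmem⟩, Subtype.ext hq⟩

theorem invEval_one_detInv (k : Fin r) : invEval 1 (detInv n k) = 1 := by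
  refine (evalAt_det _ _).trans ?_
  rw [Pi.one_apply, Matrix.det_one]

/-- Modulo decomposables at the identity, the kernel of `proj` is spanned by determinants. -/
theorem cot_mem_span_of_proj_eq_zero (hn : 1 ≤ n) {p : invGL n r} (hp : proj n r p = 0) :
    cot (invEval (n := n) (r := r) 1) p ∈
      Submodule.span ℂ (cot (invEval (n := n) (r := r) 1) '' Set.range (detInv n)) := by
  set d := cot (invEval (n := n) (r := r) 1) with hd
  set W := Submodule.span ℂ (d '' Set.range (detInv (r := r) n))
  have h0 : restrictSL n r (p : PolyRing n r) = 0 := congrArg Subtype.val hp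
  have hz : homogenize (p : PolyRing n r) = 0 :=
    eq_zero_of_restrictSL_eq_zero hn ((restrictSL_homogenize _).trans h0)
      (multidegree_homogenize hn _)
  let c : (Fin r → ℕ) → invGL n r := fun m => ⟨multiComponent m (p : PolyRing n r),
    weightedHomogeneousComponent_mem_invGL (fun k : Fin r => (Pi.single k 1 : Fin r → ℕ)) m p.2⟩
  let u : (Fin r → ℕ) → invGL n r := detFactor n (multidegreeBound (p : PolyRing n r))
  have hsum : ∑ m ∈ multidegrees (p : PolyRing n r), c m = p := by
    apply Subtype.ext
    rw [AddSubmonoidClass.coe_finsetSum]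
    exact sum_multiComponent _
  have hsum' : ∑ m ∈ multidegrees (p : PolyRing n r), c m * u m = 0 := by
    apply Subtype.ext
    rw [AddSubmonoidClass.coe_finsetSum]
    exact hz
  have hu : ∀ m, d (u m) ∈ W := fun m => by
    have : u m ∈ cotComap (invEval (n := n) (r := r) 1) W :=
      prod_mem fun k _ => pow_mem ((mem_cotComap _).2
        (Submodule.subset_span (Set.mem_image_of_mem d (Set.mem_range_self k)))) _
    exact this
  have hu1 : ∀ m, invEval 1 (u m) = 1 := fun m => by
    change invEval 1 (∏ k, detInv n k ^ _) = 1
    rw [map_prod]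
    exact Finset.prod_eq_one fun k _ => by rw [map_pow, invEval_one_detInv, one_pow]
  -- Since u_m = 1 at the identity, differentiating Σ c_m u_m = 0 gives dp = -Σ c_m(1) du_m, and
  -- each u_m is a product of determinants.
  have h2 := congrArg d hsum'
  rw [map_zero, map_sum] at h2
  have h3 : ∀ m, d (c m * u m) = invEval 1 (c m) • d (u m) + d (c m) := fun m => by
    rw [hd, cot_mul, hu1, one_smul]
  simp only [h3, Finset.sum_add_distrib] at h2
  rw [← map_sum, hsum] at h2
  rw [eq_neg_of_add_eq_zero_right h2]
  exact neg_mem (sum_mem fun m _ => W.smul_mem _ (hu m))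

end TraceInv
-- Comparison of the two cotangent spaces and the count
namespace TraceInv

open MvPolynomial

variable {n r : ℕ}

/-- Evaluation of regular functions on `SL(n)^r` at the identity. -/
noncomputable def invSLEvalOne (n r : ℕ) : invSL n r →ₐ[ℂ] ℂ :=
  (Pi.evalAlgHom ℂ (fun _ : Fin r → SL(n, ℂ) => ℂ) 1).comp (invSL n r).val

theorem invSLEvalOne_proj (p : invGL n r) : invSLEvalOne n r (proj n r p) = invEval 1 p := by
  change restrictSL n r (p : PolyRing n r) 1 = evalAt 1 (p : PolyRing n r)
  rw [restrictSL_apply]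
  congr 2

theorem proj_detInv (k : Fin r) : proj n r (detInv n k) = 1 :=
  Subtype.ext (restrictSL_det k)

/-- An invariant whose restriction is decomposable has its differential at 1 in the span of those of
the determinants. As H is independent at 1, its other elements stay independent modulo that span. -/
theorem linearIndepOn_cot_comp_proj (hn : 1 ≤ n) {H : Set (invGL n r)} (hH : IsHomogeneousSet H)
    (hD : Set.range (detInv n) ⊆ H)
    (hli : LinearIndepOn ℂ (cot (invEval (n := n) (r := r) 0)) H) :
    LinearIndepOn ℂ (cot (invSLEvalOne n r) ∘ proj n r) (H \ Set.range (detInv n)) := by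
  have h1 := linearIndepOn_cot_one hH hli
  rw [← Set.union_sdiff_cancel hD, linearIndepOn_union_iff_quotient Set.disjoint_sdiff_right] at h1
  refine linearIndepOn_of_ker_le ((Submodule.mkQ _).comp (cot (invEval (n := n) (r := r) 1)))
    ((cot (invSLEvalOne n r)).comp (proj n r).toLinearMap) (fun x hx => ?_) h1.2
  have hx' : proj n r x ∈ decomposables (invSLEvalOne n r) := (cot_eq_zero _).1 hx
  obtain ⟨y, hy, hyx⟩ := exists_decomposables_preimage (invEval 1) _ (proj n r) invSLEvalOne_proj
    (proj_surjective hn) hx'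
  have h2 := cot_mem_span_of_proj_eq_zero hn (p := x - y) (by rw [map_sub, hyx, sub_self])
  rw [map_sub, (cot_eq_zero _).2 hy, sub_zero] at h2
  exact (Submodule.Quotient.mk_eq_zero _).2 h2

theorem adjoin_proj_image_eq_top (hn : 1 ≤ n) {H : Set (invGL n r)}
    (hH : Algebra.adjoin ℂ H = ⊤) :
    Algebra.adjoin ℂ (proj n r '' (H \ Set.range (detInv n))) = ⊤ := by
  have h1 : Algebra.adjoin ℂ (proj n r '' H) = ⊤ := by
    rw [← AlgHom.map_adjoin, hH, Algebra.map_top, (AlgHom.range_eq_top _).2 (proj_surjective hn)]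
  rw [eq_top_iff, ← h1]
  refine Algebra.adjoin_le ?_
  rintro _ ⟨h, hh, rfl⟩
  by_cases hd : h ∈ Set.range (detInv n)
  · obtain ⟨k, rfl⟩ := hd
    rw [proj_detInv]
    exact one_mem _
  · exact Algebra.subset_adjoin ⟨h, ⟨hh, hd⟩, rfl⟩

theorem detInv_injective (hn : 1 ≤ n) : Function.Injective (detInv (r := r) n) := by
  obtain ⟨φ, -, hφ1, hφ2, -⟩ := exists_dual_det (r := r) hn
  intro j k hjk
  by_contra h
  exact hφ1 k (hjk ▸ hφ2 k j h)

theorem minimal_and_encard (hn : 1 ≤ n) {H : Set (invGL n r)} (hH : IsHomogeneousSet H)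
    (hD : Set.range (detInv n) ⊆ H)
    (hli : LinearIndepOn ℂ (cot (invEval (n := n) (r := r) 0)) H)
    (hspan : Submodule.span ℂ (cot (invEval (n := n) (r := r) 0) '' H) = ⊤) :
    IsMinimalGenerating (proj n r '' (H \ Set.range (detInv n))) ∧
    (proj n r '' (H \ Set.range (detInv n))).encard = minNumGenerators (invSL n r) ∧
    minNumGenerators (invSL n r) + (r : ℕ∞) = minNumGenerators (invGL n r) := by
  have hgen := adjoin_eq_top_of_span_cot hH hspan
  have hgen' := adjoin_proj_image_eq_top hn hgen
  have hcomp := linearIndepOn_cot_comp_proj hn hH hD hli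
  have hli' := LinearIndepOn.image_of_comp _ _ hcomp
  have hcard := encard_eq_minNumGenerators _ hli' hgen'
  refine ⟨isMinimalGenerating_of_linearIndepOn_cot _ hli' hgen', hcard, ?_⟩
  have hinj : Set.InjOn (proj n r) (H \ Set.range (detInv n)) :=
    Set.InjOn.of_comp hcomp.injOn
  rw [← hcard, hinj.encard_image, ← encard_eq_minNumGenerators _ hli hgen,
    ← Set.encard_sdiff_add_encard_of_subset hD, ← Set.image_univ,
    (detInv_injective hn).encard_image, Set.encard_univ, ENat.card_eq_coe_fintype_card,
    Fintype.card_fin]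

theorem linearIndepOn_cot_detInv (hn : 1 ≤ n) :
    LinearIndepOn ℂ (cot (invEval (n := n) (r := r) 0)) (Set.range (detInv n)) := by
  obtain ⟨φ, hφ0, hφ1, hφ2, -⟩ := exists_dual_det (r := r) hn
  rw [linearIndepOn_range_iff (detInv_injective hn), Fintype.linearIndependent_iff]
  intro c hc k
  have h : ∑ j, c j • detInv n j ∈ decomposables (invEval (n := n) (r := r) 0) := by
    rw [← cot_eq_zero]
    simpa using hc
  have h2 := hφ0 k _ h
  rw [map_sum, Finset.sum_eq_single k] at h2
  · rw [map_smul, smul_eq_mul] at h2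
    exact (mul_eq_zero.1 h2).resolve_right (hφ1 k)
  · intro j _ hj
    rw [map_smul, hφ2 k j hj, smul_zero]
  · simp

/-- The dual functionals vanish on S and on decomposables but read off the coefficient of each
determinant. -/
theorem disjoint_span_cot (hn : 1 ≤ n) {S : Set (invGL n r)}
    (hS : ∀ s ∈ S, ∃ w : List (Fin r), s = traceInv n w) (hP : Disjoint S (powerTraces n r)) :
    Disjoint (Submodule.span ℂ (cot (invEval (n := n) (r := r) 0) '' S))
      (Submodule.span ℂ (cot (invEval (n := n) (r := r) 0) '' Set.range (detInv n))) := by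
  obtain ⟨φ, hφ0, hφ1, hφ2, hφ3⟩ := exists_dual_det (r := r) hn
  rw [← Submodule.map_span, ← Submodule.map_span, Submodule.disjoint_def]
  rintro _ ⟨y, hy, rfl⟩ ⟨z, hz, hzy⟩
  obtain ⟨c, rfl⟩ := (Submodule.mem_span_range_iff_exists_fun ℂ).1 hz
  have hy0 : ∀ k, φ k y = 0 := fun k => by
    suffices h : Submodule.span ℂ S ≤ LinearMap.ker (φ k) from h hy
    refine Submodule.span_le.2 fun s hs => ?_
    obtain ⟨w, rfl⟩ := hS s hs
    exact hφ3 k w (Set.disjoint_left.1 hP hs)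
  have hc : ∀ k, c k = 0 := fun k => by
    have h := hφ0 k (∑ j, c j • detInv n j - y)
      ((cot_eq_zero _).1 (by rw [map_sub, hzy, sub_self]))
    rw [map_sub, hy0, sub_zero, map_sum, Finset.sum_eq_single k] at h
    · rw [map_smul, smul_eq_mul] at h
      exact (mul_eq_zero.1 h).resolve_right (hφ1 k)
    · intro j _ hj
      rw [map_smul, hφ2 k j hj, smul_zero]
    · simp
  rw [← hzy]
  simp [hc]

theorem disjoint_detInv (hn : 1 ≤ n) {S : Set (invGL n r)}
    (hS : ∀ s ∈ S, ∃ w : List (Fin r), s = traceInv n w) (hP : Disjoint S (powerTraces n r)) :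
    Disjoint S (Set.range (detInv n)) := by
  obtain ⟨φ, -, hφ1, -, hφ3⟩ := exists_dual_det (r := r) hn
  rw [Set.disjoint_right]
  rintro _ ⟨k, rfl⟩ hk
  obtain ⟨w, hw⟩ := hS _ hk
  exact hφ1 k (hw ▸ hφ3 k w (hw ▸ Set.disjoint_left.1 hP hk))

/-- Extending the determinants to a basis of I/I² by homogeneous invariants makes this independent
of the existence of Procesi generators. -/
theorem minNumGenerators_invSL_add (hn : 1 ≤ n) :
    minNumGenerators (invSL n r) + (r : ℕ∞) = minNumGenerators (invGL n r) := by
  let t : Set (invGL n r) := {p | ∃ m, (p : PolyRing n r).IsHomogeneous m}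
  have hs := linearIndepOn_cot_detInv (n := n) (r := r) hn
  have hst : Set.range (detInv n) ⊆ t := by
    rintro _ ⟨k, rfl⟩
    exact ⟨n, isHomogeneous_detInv k⟩
  have ht : Algebra.adjoin ℂ t = ⊤ := eq_top_iff.2 fun p _ => by
    rw [← sum_invComponent p]
    exact sum_mem fun i _ => Algebra.subset_adjoin ⟨i, invComponent_isHomogeneous i p⟩
  exact (minimal_and_encard hn (fun s h => hs.extend_subset hst h) (hs.subset_extend hst)
    (hs.linearIndepOn_extend hst)
    ((hs.span_image_extend_eq_span_image hst).trans (span_cot_eq_top _ ht))).2.2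

end TraceInv

theorem mainTheorem6 (n r : ℕ) (hn : 1 ≤ n) :
    (∀ G : Set (TraceInv.invGL n r),
      TraceInv.IsProcesiGenerators G → TraceInv.IsMinimalGenerating G →
        TraceInv.IsMinimalGenerating
          (TraceInv.proj n r '' (G \ TraceInv.powerTraces n r)) ∧
        (TraceInv.proj n r '' (G \ TraceInv.powerTraces n r)).encard + (r : ℕ∞) = G.encard ∧
        G.encard = TraceInv.minNumGenerators (TraceInv.invGL n r) ∧
        (TraceInv.proj n r '' (G \ TraceInv.powerTraces n r)).encard =
          TraceInv.minNumGenerators (TraceInv.invSL n r)) ∧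
    TraceInv.minNumGenerators (TraceInv.invSL n r) + (r : ℕ∞) =
      TraceInv.minNumGenerators (TraceInv.invGL n r) := by
  refine ⟨fun G hP hmin => ?_, TraceInv.minNumGenerators_invSL_add hn⟩
  have hG : TraceInv.IsHomogeneousSet G := fun s hs => by
    obtain ⟨w, rfl⟩ := hP.isTrace s hs
    exact ⟨_, TraceInv.isHomogeneous_traceWord w⟩
  have hli := TraceInv.linearIndepOn_cot_of_isMinimalGenerating hG hmin
  have hGcard := TraceInv.encard_eq_minNumGenerators _ hli hmin.prop
  have htr : ∀ s ∈ G \ TraceInv.powerTraces n r, ∃ w : List (Fin r), s = TraceInv.traceInv n w :=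
    fun s hs => hP.isTrace s hs.1
  have hdis : Disjoint (G \ TraceInv.powerTraces n r) (TraceInv.powerTraces n r) :=
    Set.disjoint_sdiff_left
  have hdiff : (G \ TraceInv.powerTraces n r ∪ Set.range (TraceInv.detInv n)) \
      Set.range (TraceInv.detInv n) = G \ TraceInv.powerTraces n r := by
    rw [Set.union_sdiff_right, sdiff_eq_left]
    exact TraceInv.disjoint_detInv hn htr hdis
  have hspan : Submodule.span ℂ (TraceInv.cot (TraceInv.invEval (n := n) (r := r) 0) ''
      (G \ TraceInv.powerTraces n r ∪ Set.range (TraceInv.detInv n))) = ⊤ := by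
    rw [eq_top_iff, ← TraceInv.span_cot_eq_top _ hmin.prop, Submodule.span_le]
    rintro _ ⟨g, hg, rfl⟩
    by_cases hgP : g ∈ TraceInv.powerTraces n r
    · obtain ⟨k, rfl⟩ := hgP
      refine Submodule.span_mono ?_ (TraceInv.cot_powerTrace_mem hn k)
      rw [Set.singleton_subset_iff]
      exact Set.mem_image_of_mem _ (Or.inr ⟨k, rfl⟩)
    · exact Submodule.subset_span (Set.mem_image_of_mem _ (Or.inl ⟨hg, hgP⟩))
  -- Exchange: replacing the power traces in G by all r determinants gives another homogeneous basis
  -- of I/I² at 0. Restriction sends the determinants to 1, leaving the image of the rest of G.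
  have key := TraceInv.minimal_and_encard hn
    (H := G \ TraceInv.powerTraces n r ∪ Set.range (TraceInv.detInv n))
    (by
      rintro s (hs | ⟨k, rfl⟩)
      · exact hG s hs.1
      · exact ⟨n, TraceInv.isHomogeneous_detInv k⟩)
    Set.subset_union_right
    ((hli.mono Set.sdiff_subset).union (TraceInv.linearIndepOn_cot_detInv hn)
      (TraceInv.disjoint_span_cot hn htr hdis)) hspan
  rw [hdiff] at key
  obtain ⟨h1, h2, h3⟩ := key
  exact ⟨h1, by rw [h2, h3, hGcard], hGcard, h2⟩
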